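/- A Boolean circuit on $n$ variables is an acyclic network of AND and OR gates of unbounded fan-in and fan-out whose inputs are the variables and the constants, and in which any wire may be negated at no cost. Its size is the number of its AND and OR gates, and its depth is the largest number of AND and OR gates on a path from an input to the output. For $|\delta|\le 1$ let $x^{\delta}=(x^{\delta}_1,\dots,x^{\delta}_n)$ consist of independent random variables with values in $\{-1,1\}$ and expectation $\delta$ each. For every integer $d\ge 1$ there is a constant $K_d>0$, depending only on $d$, such that the following holds for all integers $n\ge 0$ and $s\ge 2$ and all real $\varepsilon$ with $|\varepsilon|\le 1$: if $f:\{-1,1\}^n\to\{-1,1\}$ is computed by a Boolean circuit of size at most $s$ and depth at most $d$ (with $-1$ read as true and $1$ as false), then $$\bigl|\mathbb{E}\,f(x^{\varepsilon})-\mathbb{E}\,f(x^{0})\bigr|\;\le\;|\varepsilon|\cdot K_d\,(\log s)^{d-1}.$$ -/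

import Mathlib

/-- What a wire of a circuit on `n` variables can come from, when `m` gates are available:
a constant, an input variable or one of the gates. -/
inductive CircuitNode (n m : ℕ) : Type where
  | const (b : Bool) : CircuitNode n m
  | var (i : Fin n) : CircuitNode n m
  | gate (j : Fin m) : CircuitNode n m

/-- A wire is a node together with a mark saying whether it is negated. -/
structure CircuitWire (n m : ℕ) : Type where
  node : CircuitNode n m
  negated : Bool

/-- The value carried by a wire, given the input bits and the values of the gates. -/
def CircuitWire.eval {n m : ℕ} (x : Fin n → Bool) (g : Fin m → Bool) (w : CircuitWire n m) :
    Bool :=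
  xor w.negated
    (match w.node with
      | .const b => b
      | .var i => x i
      | .gate j => g j)

/-- The depth of the node a wire comes from, given the depths of the gates. -/
def CircuitWire.depth {n m : ℕ} (g : Fin m → ℕ) (w : CircuitWire n m) : ℕ :=
  match w.node with
  | .const _ => 0
  | .var _ => 0
  | .gate j => g j

/-- A Boolean circuit on `n` variables: an acyclic network of AND and OR gates of unbounded
fan-in and fan-out, in which any wire may carry a negation. The gates are listed in a topological
order, so that gate `i` reads only variables, constants and the gates before `i`. The size is the
number of AND and OR gates; negations are free. -/
structure BoolCircuit (n : ℕ) : Type where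
  size : ℕ
  /-- `true` for an AND gate, `false` for an OR gate -/
  isAnd : Fin size → Bool
  inputs : (i : Fin size) → Finset (CircuitWire n i.val)
  output : CircuitWire n size

namespace BoolCircuit

variable {n : ℕ}

/-- The value of a gate on the input bits `x`. -/
def gateVal (C : BoolCircuit n) (x : Fin n → Bool) (i : Fin C.size) : Bool :=
  if C.isAnd i then
    decide (∀ w ∈ C.inputs i,
      w.eval x (fun j : Fin i.val => gateVal C x ⟨j.val, j.isLt.trans i.isLt⟩) = true)
  else
    decide (∃ w ∈ C.inputs i,
      w.eval x (fun j : Fin i.val => gateVal C x ⟨j.val, j.isLt.trans i.isLt⟩) = true)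
termination_by i.val
decreasing_by all_goals exact j.isLt

/-- The largest number of AND and OR gates on a directed path that ends in gate `i`. -/
def gateDepth (C : BoolCircuit n) (i : Fin C.size) : ℕ :=
  1 + (C.inputs i).sup (fun w =>
    w.depth (fun j : Fin i.val => gateDepth C ⟨j.val, j.isLt.trans i.isLt⟩))
termination_by i.val
decreasing_by all_goals exact j.isLt

/-- The output bit of the circuit on the input bits `x`. -/
def eval (C : BoolCircuit n) (x : Fin n → Bool) : Bool :=
  C.output.eval x (C.gateVal x)

/-- The depth: the largest number of AND and OR gates on a path from an input to the output. -/
def depth (C : BoolCircuit n) : ℕ :=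
  C.output.depth C.gateDepth

end BoolCircuit

/-- The bit encoded by an element of `{-1, 1}`: `-1` stands for true, `1` for false. -/
def signToBool (u : ℤˣ) : Bool := decide (u = -1)

/-- `f : {-1, 1}ⁿ → {-1, 1}` is computed by a Boolean circuit of size at most `s` and depth at
most `d`. -/
def ComputableByCircuit {n : ℕ} (f : (Fin n → ℤˣ) → ℤˣ) (s d : ℕ) : Prop :=
  ∃ C : BoolCircuit n, C.size ≤ s ∧ C.depth ≤ d ∧
    ∀ x : Fin n → ℤˣ, C.eval (fun i => signToBool (x i)) = signToBool (f x)

/-- The probability that `n` independent `{-1, 1}`-valued coins, each of expectation `δ`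
(so that each has value `u` with probability `(1 + δ * u) / 2`), show the pattern `x`. -/
noncomputable def coinProb {n : ℕ} (δ : ℝ) (x : Fin n → ℤˣ) : ℝ :=
  ∏ i, (1 + δ * (((x i : ℤˣ) : ℤ) : ℝ)) / 2

/-- The expectation of `f` on `n` independent `{-1, 1}`-valued coins of expectation `δ`. -/
noncomputable def coinExpectation {n : ℕ} (δ : ℝ) (f : (Fin n → ℤˣ) → ℤˣ) : ℝ :=
  ∑ x : Fin n → ℤˣ, coinProb δ x * (((f x : ℤˣ) : ℤ) : ℝ)

/-! Random restrictions turn small bias into large bias. If `ρ` leaves each variable free with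
probability `p` and the free ones get coins of expectation `δ`, the result is coins of expectation
`p * δ` (`sum_restrictionProb_mul_biasedMean`). So if the restricted function moves by at most `|δ|
* B` on average, the original moves by at most `|ε| * (B / p)`; biases above `p` are covered by the
trivial bound 2 (`abs_biasedMean_sub_le_of_restrict`).

A decision tree of depth `t` moves by at most `|δ| * t`, and the switching lemma (`IsDNF.switches`)
makes the tree depth of a width-`w` DNF have mean at most 1 for `p = 1 / (32 * w)`. Hence such a DNF
moves by at most `64 * w * |ε|`.

For a circuit, each restriction turns one more layer of gates into trees of depth `t = O(log s)`, so
the next layer consists of width-`t` DNFs up to negation (`Shallow.isDNF`), at the cost of a factor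
`64 * t` (`Shallow.step`). The bottom layer has width 1 and costs only 64, which leaves the exponent
`d - 1`. The switching fails with probability at most `s / 2 ^ (t + 1)`; there the crude bound `32 *
s * |δ|` (`abs_biasedMean_sub_le_of_size`) keeps the loss linear in `δ`, which the trivial bound 2
would not. -/

/-! ### Restrictions and decision trees -/

section Restrictions

variable {ι : Type*}

/-- The point that agrees with the restriction `ρ` where `ρ` is fixed, and with `x` elsewhere. -/
def subst (ρ : ι → Option Bool) (x : ι → Bool) : ι → Bool := fun i => (ρ i).getD (x i)

/-- The restriction of a Boolean function. -/
def restrict (f : (ι → Bool) → Bool) (ρ : ι → Option Bool) : (ι → Bool) → Bool :=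
  fun x => f (subst ρ x)

theorem restrict_restrict (f : (ι → Bool) → Bool) (θ ρ : ι → Option Bool) :
    restrict (restrict f θ) ρ = restrict f (fun i => (θ i).or (ρ i)) := by
  funext x
  simp only [restrict]
  congr 1
  funext i
  simp only [subst]
  cases θ i <;> simp

theorem restrict_none (f : (ι → Bool) → Bool) : restrict f (fun _ => none) = f := rfl

/-- `f` is computed by a decision tree of depth at most `t`. -/
inductive HasDT [DecidableEq ι] : ℕ → ((ι → Bool) → Bool) → Prop
  | leaf (t : ℕ) (f : (ι → Bool) → Bool) : (∀ x y, f x = f y) → HasDT t f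
  | query (t : ℕ) (f : (ι → Bool) → Bool) (i : ι) :
      (∀ b, HasDT t (fun x => f (Function.update x i b))) → HasDT (t + 1) f

variable [DecidableEq ι]

theorem HasDT.mono {t u : ℕ} {f : (ι → Bool) → Bool} (h : HasDT t f) (htu : t ≤ u) :
    HasDT u f := by
  induction h generalizing u with
  | leaf t f hf => exact .leaf _ _ hf
  | query t f i _ ih =>
    obtain ⟨v, rfl⟩ : ∃ v, u = v + 1 := ⟨u - 1, by omega⟩
    exact .query _ _ i fun b => ih b (by omega)

theorem HasDT.comp {t : ℕ} {f : (ι → Bool) → Bool} (h : HasDT t f) (c : Bool → Bool) :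
    HasDT t (fun x => c (f x)) := by
  induction h with
  | leaf t f hf => exact .leaf _ _ fun x y => by rw [hf x y]
  | query t f i _ ih => exact .query _ _ i ih

theorem subst_update (θ : ι → Option Bool) (x : ι → Bool) (i : ι) (b : Bool) :
    Function.update (subst θ x) i b = subst (Function.update θ i (some b)) x := by
  funext j
  by_cases hj : j = i
  · subst hj; simp [subst]
  · simp [subst, hj]

theorem HasDT.restrict {t : ℕ} {f : (ι → Bool) → Bool} (h : HasDT t f) (ρ : ι → Option Bool) :
    HasDT t (restrict f ρ) := by
  induction h with
  | leaf t f hf => exact .leaf _ _ fun x y => hf _ _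
  | query t f i _ ih =>
    cases hi : ρ i with
    | none =>
      refine .query _ _ i fun b => ?_
      convert ih b using 1
      funext x
      simp only [_root_.restrict]
      congr 1
      funext j
      by_cases hj : j = i
      · subst hj; simp [_root_.subst, hi]
      · simp [_root_.subst, hj]
    | some b =>
      refine HasDT.mono ?_ (Nat.le_succ t)
      convert ih b using 1
      funext x
      simp only [_root_.restrict]
      congr 1
      rw [subst_update, ← hi, Function.update_eq_self]

/-- Graft trees for `f` onto the leaves of a tree for `h`: the path to a leaf is a restriction that
makes `h` constant. -/
theorem HasDT.bind {a b : ℕ} {h f : (ι → Bool) → Bool} (hh : HasDT a h)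
    (hf : ∀ θ, (∀ x y, _root_.restrict h θ x = _root_.restrict h θ y) →
      HasDT b (_root_.restrict f θ)) : HasDT (a + b) f := by
  induction hh generalizing f with
  | leaf t h hc => exact (hf (fun _ => none) hc).mono (by omega)
  | query t h i _ ih =>
    rw [show t + 1 + b = (t + b) + 1 by omega]
    refine .query _ _ i fun c => ih c fun θ hθ => ?_
    have key : ∀ g : (ι → Bool) → Bool,
        _root_.restrict (fun x => g (Function.update x i c)) θ
          = _root_.restrict g (Function.update θ i (some c)) := by
      intro g; funext x; simp only [_root_.restrict, subst_update]
    rw [key]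
    rw [key] at hθ
    exact hf _ hθ

/-- Run the trees of the `h j` one after another; along the resulting path all of them, and hence
`f`, are constant. -/
theorem HasDT.of_determined {κ : Type*} [DecidableEq κ] (J : Finset κ) (t : κ → ℕ)
    (h : κ → (ι → Bool) → Bool) (f : (ι → Bool) → Bool)
    (hdet : ∀ x y, (∀ j ∈ J, h j x = h j y) → f x = f y)
    (hh : ∀ j ∈ J, HasDT (t j) (h j)) : HasDT (∑ j ∈ J, t j) f := by
  induction J using Finset.induction_on generalizing h f with
  | empty => exact .leaf _ _ fun x y => hdet x y (by simp)
  | insert a J ha ih =>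
    rw [Finset.sum_insert ha]
    refine HasDT.bind (hh a (Finset.mem_insert_self a J)) fun θ hθ => ?_
    refine ih (fun j => _root_.restrict (h j) θ) _ (fun x y hxy => hdet _ _ fun j hj => ?_)
      fun j hj => (hh j (Finset.mem_insert_of_mem hj)).restrict θ
    rcases Finset.mem_insert.1 hj with rfl | hj
    · exact hθ x y
    · exact hxy j hj

theorem HasDT.of_forall_assignment (Y : Finset ι) (t : ℕ) (f : (ι → Bool) → Bool)
    (h : ∀ π : ι → Bool,
      HasDT t (_root_.restrict f (fun i => if i ∈ Y then some (π i) else none))) :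
    HasDT (Y.card + t) f := by
  induction Y using Finset.induction_on generalizing f with
  | empty => simpa [restrict_none] using h (fun _ => true)
  | insert a Y ha ih =>
    rw [Finset.card_insert_of_notMem ha, show Y.card + 1 + t = (Y.card + t) + 1 by omega]
    refine .query _ _ a fun b => ih _ fun π => ?_
    convert h (Function.update π a b) using 1
    funext x
    simp only [_root_.restrict]
    congr 1
    funext i
    by_cases hi : i = a
    · subst hi; simp [_root_.subst]
    · simp [_root_.subst, hi]

/-- The decision tree depth of a Boolean function. -/
noncomputable def dt (f : (ι → Bool) → Bool) : ℕ := sInf {t | HasDT t f}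

theorem dt_le_of_hasDT {f : (ι → Bool) → Bool} {t : ℕ} (h : HasDT t f) : dt f ≤ t :=
  Nat.sInf_le h

theorem dt_eq_zero {f : (ι → Bool) → Bool} (h : ∀ x y, f x = f y) : dt f = 0 :=
  Nat.le_zero.1 (dt_le_of_hasDT (.leaf _ _ h))

variable [Fintype ι]

theorem hasDT_card (f : (ι → Bool) → Bool) : HasDT (Fintype.card ι) f := by
  have := HasDT.of_forall_assignment Finset.univ 0 f fun π => .leaf _ _ fun x y => by
    simp only [restrict, Finset.mem_univ, if_true]
    rfl
  simpa using this

theorem hasDT_dt (f : (ι → Bool) → Bool) : HasDT (dt f) f :=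
  Nat.sInf_mem (s := {t | HasDT t f}) ⟨_, hasDT_card f⟩

theorem dt_le_card (f : (ι → Bool) → Bool) : dt f ≤ Fintype.card ι :=
  dt_le_of_hasDT (hasDT_card f)

theorem dt_comp_not (f : (ι → Bool) → Bool) (c : Bool) : dt (fun x => xor c (f x)) = dt f := by
  refine le_antisymm (dt_le_of_hasDT ((hasDT_dt f).comp _)) (dt_le_of_hasDT ?_)
  convert (hasDT_dt (fun x => xor c (f x))).comp (xor c) using 1
  funext x
  cases c <;> simp

end Restrictions

/-! ### Terms and DNFs -/

section Terms

variable {ι : Type*}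

/-- The point `x` satisfies the term (conjunction of literals) `T`. -/
def Sat (T : ι → Option Bool) (x : ι → Bool) : Prop := ∀ i b, T i = some b → x i = b

/-- The variables of a term. -/
def termVars [Fintype ι] (T : ι → Option Bool) : Finset ι :=
  Finset.univ.filter fun i => T i ≠ none

theorem mem_termVars [Fintype ι] {T : ι → Option Bool} {i : ι} : i ∈ termVars T ↔ T i ≠ none := by
  simp [termVars]

/-- `f` is a disjunction of terms of width at most `w`. -/
def IsDNF [Fintype ι] (w : ℕ) (f : (ι → Bool) → Bool) : Prop :=
  ∀ x, f x = true → ∃ T, (termVars T).card ≤ w ∧ Sat T x ∧ ∀ y, Sat T y → f y = true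

variable [Fintype ι] [DecidableEq ι]

/-- The term records the answers on the path that `x` follows through the tree. -/
theorem HasDT.exists_term {t : ℕ} {f : (ι → Bool) → Bool} (h : HasDT t f) (x : ι → Bool) :
    ∃ T, (termVars T).card ≤ t ∧ Sat T x ∧ ∀ y, Sat T y → f y = f x := by
  induction h with
  | leaf t f hf => exact ⟨fun _ => none, by simp [termVars], by simp [Sat], fun y _ => hf y x⟩
  | query t f i _ ih =>
    obtain ⟨T, hT, hx, hy⟩ := ih (x i)
    refine ⟨Function.update T i (some (x i)), ?_, ?_, ?_⟩
    · refine (Finset.card_le_card (t := insert i (termVars T)) fun j hj => ?_).trans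
        ((Finset.card_insert_le _ _).trans (by omega))
      by_cases hji : j = i
      · simp [hji]
      · rw [mem_termVars, Function.update_of_ne hji] at hj
        exact Finset.mem_insert_of_mem (mem_termVars.2 hj)
    · intro j b hj
      by_cases hji : j = i
      · subst hji; simpa using hj
      · rw [Function.update_of_ne hji] at hj
        exact hx j b hj
    · intro y hsat
      have hyi : y i = x i := hsat i (x i) (by simp)
      have := hy y fun j b hj => ?_
      · have h2 : Function.update y i (x i) = y := by rw [← hyi, Function.update_eq_self]
        simpa only [h2, Function.update_eq_self] using this
      · by_cases hji : j = i
        · subst hji; rw [hyi]; exact hx j b hj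
        · exact hsat j b (by rwa [Function.update_of_ne hji])

theorem IsDNF.of_exists {κ : Type*} {w : ℕ} {f : (ι → Bool) → Bool} (A : κ → Prop)
    (g : κ → (ι → Bool) → Bool) (hf : ∀ x, f x = true ↔ ∃ a, A a ∧ g a x = true)
    (hg : ∀ a, A a → HasDT w (g a)) : IsDNF w f := by
  intro x hx
  obtain ⟨a, ha, hax⟩ := (hf x).1 hx
  obtain ⟨T, hT, hTx, hTy⟩ := (hg a ha).exists_term x
  exact ⟨T, hT, hTx, fun y hy => (hf y).2 ⟨a, ha, by rw [hTy y hy, hax]⟩⟩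

end Terms

/-! ### Probabilities of events under random restrictions -/

section Mass

variable {ι : Type*} [Fintype ι]

/-- The probability of a restriction that leaves each variable free with probability `p` and
fixes it to either bit with probability `(1 - p) / 2`, independently. -/
noncomputable def restrictionProb (p : ℝ) (ρ : ι → Option Bool) : ℝ :=
  ∏ i, if ρ i = none then p else (1 - p) / 2

theorem restrictionProb_nonneg {p : ℝ} (h0 : 0 ≤ p) (h1 : p ≤ 1) (ρ : ι → Option Bool) :
    0 ≤ restrictionProb p ρ :=
  Finset.prod_nonneg fun i _ => by split_ifs <;> linarith

variable [DecidableEq ι]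

open Classical in
/-- The probability that a random restriction satisfies `P`. -/
noncomputable def mass (p : ℝ) (P : (ι → Option Bool) → Prop) : ℝ :=
  ∑ ρ, if P ρ then restrictionProb p ρ else 0

variable {p : ℝ} (h0 : 0 ≤ p) (h1 : p ≤ 1)
include h0 h1

theorem mass_nonneg (P : (ι → Option Bool) → Prop) : 0 ≤ mass p P :=
  Finset.sum_nonneg fun ρ _ => by
    split_ifs
    exacts [restrictionProb_nonneg h0 h1 ρ, le_rfl]

theorem mass_mono {P Q : (ι → Option Bool) → Prop} (h : ∀ ρ, P ρ → Q ρ) :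
    mass p P ≤ mass p Q := by
  classical
  refine Finset.sum_le_sum fun ρ _ => ?_
  have := restrictionProb_nonneg h0 h1 ρ
  by_cases hP : P ρ
  · simp [hP, h ρ hP]
  · rw [if_neg hP]; split_ifs <;> simp [this]

theorem mass_add_le {P Q R : (ι → Option Bool) → Prop} (hP : ∀ ρ, P ρ → R ρ)
    (hQ : ∀ ρ, Q ρ → R ρ) (hPQ : ∀ ρ, P ρ → ¬ Q ρ) : mass p P + mass p Q ≤ mass p R := by
  classical
  rw [mass, mass, mass, ← Finset.sum_add_distrib]
  refine Finset.sum_le_sum fun ρ _ => ?_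
  have := restrictionProb_nonneg h0 h1 ρ
  by_cases h : P ρ
  · simp [h, hP ρ h, hPQ ρ h]
  · by_cases h' : Q ρ
    · simp [h, h', hQ ρ h']
    · simp only [h, h', if_false]; split_ifs <;> simp [this]

theorem mass_le_add {P Q R : (ι → Option Bool) → Prop} (h : ∀ ρ, P ρ → Q ρ ∨ R ρ) :
    mass p P ≤ mass p Q + mass p R := by
  classical
  rw [mass, mass, mass, ← Finset.sum_add_distrib]
  refine Finset.sum_le_sum fun ρ _ => ?_
  have := restrictionProb_nonneg h0 h1 ρ
  by_cases hP : P ρ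
  · rcases h ρ hP with h | h <;> simp only [hP, h, if_true] <;> split_ifs <;> linarith
  · rw [if_neg hP]; split_ifs <;> linarith

theorem mass_le_sum {κ : Type*} (s : Finset κ) {P : (ι → Option Bool) → Prop}
    {Q : κ → (ι → Option Bool) → Prop} (h : ∀ ρ, P ρ → ∃ a ∈ s, Q a ρ) :
    mass p P ≤ ∑ a ∈ s, mass p (Q a) := by
  classical
  simp only [mass]
  rw [Finset.sum_comm]
  refine Finset.sum_le_sum fun ρ _ => ?_
  have h3 := restrictionProb_nonneg h0 h1 ρ
  have h2 : ∀ a ∈ s, (0 : ℝ) ≤ if Q a ρ then restrictionProb p ρ else 0 := fun a _ => by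
    split_ifs <;> simp [h3]
  by_cases hP : P ρ
  · obtain ⟨a, ha, hQ⟩ := h ρ hP
    have := Finset.single_le_sum h2 ha
    simpa [hP, hQ] using this
  · rw [if_neg hP]; exact Finset.sum_nonneg h2

/-- The encoding argument in the switching lemma: an injection into likelier restrictions bounds the
probability of its domain. -/
theorem mass_le_mul_of_injOn {P Q : (ι → Option Bool) → Prop} {c : ℝ} (hc : 0 ≤ c)
    (e : (ι → Option Bool) → (ι → Option Bool))
    (he : ∀ ρ ρ', P ρ → P ρ' → e ρ = e ρ' → ρ = ρ') (hPQ : ∀ ρ, P ρ → Q (e ρ))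
    (hw : ∀ ρ, P ρ → restrictionProb p ρ ≤ c * restrictionProb p (e ρ)) :
    mass p P ≤ c * mass p Q := by
  classical
  simp only [mass]
  rw [← Finset.sum_filter, ← Finset.sum_filter]
  calc _ ≤ ∑ ρ ∈ Finset.univ.filter P, c * restrictionProb p (e ρ) :=
        Finset.sum_le_sum fun ρ hρ => hw ρ (Finset.mem_filter.1 hρ).2
    _ = c * ∑ ρ ∈ (Finset.univ.filter P).image e, restrictionProb p ρ := by
        rw [← Finset.mul_sum, Finset.sum_image]
        intro ρ hρ ρ' hρ' h
        exact he ρ ρ' (by simpa using hρ) (by simpa using hρ') h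
    _ ≤ _ := by
        refine mul_le_mul_of_nonneg_left (Finset.sum_le_sum_of_subset_of_nonneg ?_
          fun ρ _ _ => restrictionProb_nonneg h0 h1 ρ) hc
        intro ρ hρ
        obtain ⟨ρ', h, rfl⟩ := Finset.mem_image.1 hρ
        simpa using hPQ ρ' (by simpa using h)

end Mass

/-! ### The switching lemma, by induction on the terms -/

section Switching

variable {ι : Type*} [Fintype ι] [DecidableEq ι]

/-- A family of restrictions that is closed under fixing further variables. -/
def DownClosed (Δ : (ι → Option Bool) → Prop) : Prop :=
  ∀ ρ ρ', Δ ρ → (∀ i b, ρ i = some b → ρ' i = some b) → Δ ρ'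

/-- Under a random restriction, also when conditioned on a down-closed family, the decision tree
depth of `f` has a geometric tail. -/
def Switches (p : ℝ) (f : (ι → Bool) → Bool) : Prop :=
  ∀ Δ : (ι → Option Bool) → Prop, DownClosed Δ → ∀ t : ℕ,
    mass p (fun ρ => Δ ρ ∧ t ≤ dt (restrict f ρ)) ≤ (1 / 2) ^ t * mass p Δ

variable {p : ℝ} (h0 : 0 ≤ p) (h1 : p ≤ 1)
include h0 h1

theorem Switches.of_const {f : (ι → Bool) → Bool} (hf : ∀ x y, f x = f y) : Switches p f := by
  intro Δ _ t
  rcases t with _ | t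
  · rw [pow_zero, one_mul]
    exact mass_mono h0 h1 fun ρ h => h.1
  · refine le_trans (le_of_eq ?_) (mul_nonneg (by positivity) (mass_nonneg h0 h1 Δ))
    refine Finset.sum_eq_zero fun ρ _ => if_neg fun h => ?_
    have := dt_eq_zero (f := restrict f ρ) fun x y => hf _ _
    omega

omit h0 h1 in
-- Otherwise querying all of `Y` first would give too shallow a tree. The set `Z` lists the
-- variables set to true.
theorem exists_assignment_dt {f : (ι → Bool) → Bool} {t : ℕ} (ht : t ≤ dt f) (Y : Finset ι) :
    ∃ Z ∈ Y.powerset, t - Y.card ≤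
      dt (restrict f (fun i => if i ∈ Y then some (decide (i ∈ Z)) else none)) := by
  by_contra! hcon
  rcases Nat.eq_zero_or_pos (t - Y.card) with h | h
  · have := hcon ∅ (by simp)
    omega
  · have := HasDT.of_forall_assignment Y (t - Y.card - 1) f fun π => ?_
    · have := dt_le_of_hasDT this
      omega
    · have h2 := hcon (Y.filter fun i => π i = true) (by simp)
      refine (hasDT_dt _).mono ?_
      have h3 : (fun i => if i ∈ Y then some (decide (i ∈ Y.filter fun i => π i = true)) else none)
          = (fun i => if i ∈ Y then some (π i) else none) := by
        funext i
        by_cases hi : i ∈ Y <;> simp [hi]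
      rw [h3] at h2
      omega

/-- The part of the switching lemma where the restriction leaves exactly the variables `Y` of
the term `T` free, satisfies the others, and `Y` is then set to `Z`. -/
theorem mass_free_vars_le {q : ℝ} (hq : 0 ≤ q) (hpq : p = q * ((1 - p) / 2))
    {T : ι → Option Bool} {F g : (ι → Bool) → Bool}
    (hF : ∀ x, F x = true ↔ Sat T x ∨ g x = true) (hg : ∀ θ, Switches p (restrict g θ))
    {Δ : (ι → Option Bool) → Prop} (hΔ : DownClosed Δ) (t : ℕ) {Y : Finset ι}
    (hY : Y ⊆ termVars T) (Z : Finset ι) :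
    mass p (fun ρ => Δ ρ ∧ (∀ i ∈ termVars T, ρ i = if i ∈ Y then none else T i) ∧
      t - Y.card ≤ dt (restrict (restrict F ρ)
        (fun i => if i ∈ Y then some (decide (i ∈ Z)) else none))) ≤
      (1 / 2) ^ t * (2 * q) ^ Y.card * mass p (fun ρ => Δ ρ ∧ ∀ i ∈ termVars T, ρ i = T i) := by
  -- `θ` fixes every variable of `T`. Either it satisfies `T` and `F` becomes constant, or it
  -- falsifies `T` and only `g` is left; both cases switch.
  set θ : ι → Option Bool := fun i =>
    if i ∈ termVars T then (if i ∈ Y then some (decide (i ∈ Z)) else T i) else none with hθ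
  have hθs : ∀ i ∈ termVars T, ∃ b, θ i = some b := by
    intro i hi
    by_cases hiY : i ∈ Y
    · exact ⟨_, by simp only [hθ, hi, hiY, if_true]; rfl⟩
    · obtain ⟨b, hb⟩ := Option.ne_none_iff_exists'.1 (mem_termVars.1 hi)
      exact ⟨b, by simp only [hθ, hi, hiY, if_true, if_false, hb]⟩
  have hsw : Switches p (restrict F θ) := by
    by_cases hcon : ∀ i b, T i = some b → θ i = some b
    · refine Switches.of_const h0 h1 fun x y => ?_
      have : ∀ x, restrict F θ x = true := fun x =>
        (hF _).2 (Or.inl fun i b hb => by simp [subst, hcon i b hb])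
      rw [this, this]
    · push Not at hcon
      obtain ⟨i, b, hT, hne⟩ := hcon
      have : restrict F θ = restrict g θ := by
        funext x
        rw [Bool.eq_iff_iff]
        refine (hF _).trans (or_iff_right fun hs => hne ?_)
        obtain ⟨c, hc⟩ := hθs i (mem_termVars.2 (by simp [hT]))
        have := hs i b hT
        simp only [subst, hc, Option.getD_some] at this
        rw [hc, this]
      rw [this]
      exact hg θ
  -- Filling `Y` in with the values of `T` is invertible because `Y` is known, and multiplies the
  -- probability by `1 / q` per variable. It does not disturb the function, since `θ` has already
  -- fixed `Y`.
  set e : (ι → Option Bool) → ι → Option Bool := fun ρ i => if i ∈ Y then T i else ρ i with he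
  set Δ' : (ι → Option Bool) → Prop := fun ρ =>
    (∀ i ∈ termVars T, ρ i = T i) ∧ Δ (fun i => if i ∈ Y then none else ρ i) with hΔ'
  have hback : ∀ ρ : ι → Option Bool,
      (∀ i ∈ termVars T, ρ i = if i ∈ Y then none else T i) →
      (fun i => if i ∈ Y then none else e ρ i) = ρ := by
    intro ρ hρ
    funext i
    by_cases hi : i ∈ Y
    · have := hρ i (hY hi)
      simp [hi] at this ⊢
      exact this.symm
    · simp [he, hi]
  have hdc : DownClosed Δ' := by
    rintro ρ ρ' ⟨h2, h3⟩ hle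
    refine ⟨fun i hi => ?_, hΔ _ _ h3 fun i b hb => ?_⟩
    · obtain ⟨b, hb⟩ := Option.ne_none_iff_exists'.1 (mem_termVars.1 hi)
      rw [hb]
      exact hle i b (by rw [h2 i hi, hb])
    · by_cases hi : i ∈ Y
      · simp [hi] at hb
      · simp only [hi, if_false] at hb ⊢
        exact hle i b hb
  have step1 := mass_le_mul_of_injOn h0 h1 (c := q ^ Y.card) (by positivity) e
    (P := fun ρ => Δ ρ ∧ (∀ i ∈ termVars T, ρ i = if i ∈ Y then none else T i) ∧
      t - Y.card ≤ dt (restrict (restrict F ρ)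
        (fun i => if i ∈ Y then some (decide (i ∈ Z)) else none)))
    (Q := fun ρ => Δ' ρ ∧ t - Y.card ≤ dt (restrict (restrict F θ) ρ))
    (fun ρ ρ' h h' hee => by rw [← hback ρ h.2.1, ← hback ρ' h'.2.1, hee])
    (fun ρ ⟨hD, hρ, hbad⟩ => by
      refine ⟨⟨fun i hi => ?_, by rwa [hback ρ hρ]⟩, ?_⟩
      · by_cases hiY : i ∈ Y
        · simp [he, hiY]
        · simp [he, hiY, hρ i hi]
      · convert hbad using 2
        rw [restrict_restrict, restrict_restrict]
        congr 1
        funext i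
        by_cases hi : i ∈ termVars T
        · have h2 := hρ i hi
          by_cases hiY : i ∈ Y
          · simp [hθ, hi, hiY, h2]
          · obtain ⟨b, hb⟩ := Option.ne_none_iff_exists'.1 (mem_termVars.1 hi)
            simp [hθ, hi, hiY, h2, hb]
        · have hiY : i ∉ Y := fun h => hi (hY h)
          simp [hθ, hi, hiY, he])
    (fun ρ ⟨hD, hρ, hbad⟩ => by
      have : q ^ Y.card = ∏ i, if i ∈ Y then q else 1 := by
        rw [Finset.prod_ite_mem, Finset.univ_inter, Finset.prod_const]
      rw [restrictionProb, restrictionProb, this, ← Finset.prod_mul_distrib]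
      refine le_of_eq (Finset.prod_congr rfl fun i _ => ?_)
      by_cases hiY : i ∈ Y
      · have h2 := hρ i (hY hiY)
        have h3 := mem_termVars.1 (hY hiY)
        simp only [hiY, if_true] at h2
        simp only [he, hiY, h2, h3, if_true, if_false]
        exact hpq
      · simp [he, hiY])
  have step2 := hsw Δ' hdc (t - Y.card)
  have step3 : mass p Δ' ≤ mass p (fun ρ => Δ ρ ∧ ∀ i ∈ termVars T, ρ i = T i) := by
    refine mass_mono h0 h1 fun ρ h => ⟨hΔ _ _ h.2 fun i b hb => ?_, h.1⟩
    by_cases hi : i ∈ Y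
    · simp [hi] at hb
    · simpa [hi] using hb
  have hhalf : ((1 : ℝ) / 2) ^ (t - Y.card) ≤ (1 / 2) ^ t * 2 ^ Y.card := by
    have h3 : ((1 : ℝ) / 2) ^ Y.card * 2 ^ Y.card = 1 := by
      rw [← mul_pow]; norm_num
    calc ((1 : ℝ) / 2) ^ (t - Y.card)
        = (1 / 2) ^ (t - Y.card) * ((1 / 2) ^ Y.card * 2 ^ Y.card) := by rw [h3, mul_one]
      _ = (1 / 2) ^ (t - Y.card + Y.card) * 2 ^ Y.card := by rw [pow_add]; ring
      _ ≤ _ := mul_le_mul_of_nonneg_right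
          (pow_le_pow_of_le_one (by norm_num) (by norm_num) (by omega)) (by positivity)
  have hm := mass_nonneg h0 h1 Δ'
  calc _ ≤ q ^ Y.card * ((1 / 2) ^ (t - Y.card) * mass p Δ') :=
        step1.trans (mul_le_mul_of_nonneg_left step2 (by positivity))
    _ ≤ q ^ Y.card * (((1 / 2) ^ t * 2 ^ Y.card) *
          mass p (fun ρ => Δ ρ ∧ ∀ i ∈ termVars T, ρ i = T i)) := by
        refine mul_le_mul_of_nonneg_left ?_ (by positivity)
        exact mul_le_mul hhalf step3 hm (by positivity)
    _ = _ := by rw [mul_pow]; ring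

/-- If `ρ` falsifies `T`, only `g` survives; that event is down-closed, which is why `Switches`
allows conditioning. Otherwise, for `t > 0`, `ρ` leaves a nonempty set `Y` of variables of `T` free.
Summing over `Y` and its `2 ^ |Y|` settings gives `(1 + 4 * q) ^ |T| - 1 ≤ 1` times the mass where
`T` is satisfied, an event disjoint from the first. -/
theorem Switches.or_term {q : ℝ} (hq : 0 ≤ q) (hpq : p = q * ((1 - p) / 2))
    {T : ι → Option Bool} (hT : (1 + 4 * q) ^ (termVars T).card ≤ 2)
    {F g : (ι → Bool) → Bool} (hF : ∀ x, F x = true ↔ Sat T x ∨ g x = true)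
    (hg : ∀ θ, Switches p (restrict g θ)) : Switches p F := by
  intro Δ hΔ t
  rcases Nat.eq_zero_or_pos t with rfl | ht
  · rw [pow_zero, one_mul]
    exact mass_mono h0 h1 fun ρ h => h.1
  set Fals : (ι → Option Bool) → Prop := fun ρ => ∃ i b, T i = some b ∧ ρ i = some (!b) with hFals
  set S := mass p (fun ρ => Δ ρ ∧ ∀ i ∈ termVars T, ρ i = T i) with hS
  have hS0 : 0 ≤ S := mass_nonneg h0 h1 _
  have part1 : mass p (fun ρ => (Δ ρ ∧ Fals ρ) ∧ t ≤ dt (restrict F ρ)) ≤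
      (1 / 2) ^ t * mass p (fun ρ => Δ ρ ∧ Fals ρ) := by
    refine le_trans (mass_mono h0 h1 fun ρ h => ⟨h.1, ?_⟩) (hg (fun _ => none) _ ?_ t)
    · rintro ρ ρ' ⟨hD, i, b, hi, hρ⟩ hle
      exact ⟨hΔ _ _ hD hle, i, b, hi, hle _ _ hρ⟩
    · obtain ⟨⟨_, i, b, hi, hρ⟩, hb⟩ := h
      convert hb using 2
      funext x
      rw [Bool.eq_iff_iff]
      refine Iff.symm ((hF _).trans (or_iff_right fun hs => ?_))
      have := hs i b hi
      simp [subst, hρ] at this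
  have part2 : mass p (fun ρ => (Δ ρ ∧ ¬ Fals ρ) ∧ t ≤ dt (restrict F ρ)) ≤
      ∑ Y ∈ (termVars T).powerset.erase ∅, ∑ Z ∈ Y.powerset,
        (1 / 2) ^ t * (2 * q) ^ Y.card * S := by
    refine le_trans (mass_le_sum h0 h1 ((termVars T).powerset.erase ∅)
      (Q := fun Y ρ => (Δ ρ ∧ (∀ i ∈ termVars T, ρ i = if i ∈ Y then none else T i)) ∧
        t ≤ dt (restrict F ρ)) ?_) (Finset.sum_le_sum fun Y hY => ?_)
    · rintro ρ ⟨⟨hD, hnf⟩, hb⟩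
      have hag : ∀ i b, T i = some b → ρ i ≠ none → ρ i = some b := by
        intro i b hi hρ
        obtain ⟨c, hc⟩ := Option.ne_none_iff_exists'.1 hρ
        rw [hc]
        by_contra hne
        refine hnf ⟨i, b, hi, hc.trans (congrArg some ?_)⟩
        exact Bool.eq_not.2 fun h => hne (congrArg some h)
      refine ⟨(termVars T).filter fun i => ρ i = none, ?_, ⟨hD, fun i hi => ?_⟩, hb⟩
      · refine Finset.mem_erase.2 ⟨fun hemp => ?_, by simp⟩
        have : dt (restrict F ρ) = 0 := by
          have : ∀ x, restrict F ρ x = true := fun x => (hF _).2 <| Or.inl fun i b hi => by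
            have h2 : ρ i ≠ none := fun h2 => by
              have : i ∈ (termVars T).filter fun i => ρ i = none := by
                simp [mem_termVars, hi, h2]
              simp [hemp] at this
            simp [subst, hag i b hi h2]
          exact dt_eq_zero fun x y => by rw [this, this]
        omega
      · by_cases h2 : ρ i = none
        · simp [hi, h2]
        · obtain ⟨b, hb⟩ := Option.ne_none_iff_exists'.1 (mem_termVars.1 hi)
          simp [hb, hag i b hb h2]
    · refine le_trans (mass_le_sum h0 h1 Y.powerset
        (Q := fun Z ρ => Δ ρ ∧ (∀ i ∈ termVars T, ρ i = if i ∈ Y then none else T i) ∧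
          t - Y.card ≤ dt (restrict (restrict F ρ)
            (fun i => if i ∈ Y then some (decide (i ∈ Z)) else none))) ?_)
        (Finset.sum_le_sum fun Z _ => mass_free_vars_le h0 h1 hq hpq hF hg hΔ t
          (Finset.mem_powerset.1 (Finset.mem_of_mem_erase hY)) Z)
      rintro ρ ⟨⟨hD, hρ⟩, hb⟩
      obtain ⟨Z, hZ, h2⟩ := exists_assignment_dt hb Y
      exact ⟨Z, hZ, hD, hρ, h2⟩
  have hsum : ∑ Y ∈ (termVars T).powerset.erase ∅, ∑ Z ∈ Y.powerset,
        (1 / 2) ^ t * (2 * q) ^ Y.card * S ≤ (1 / 2) ^ t * S := by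
    have h2 : ∀ Y : Finset ι, ∑ Z ∈ Y.powerset, (1 / 2) ^ t * (2 * q) ^ Y.card * S =
        (4 * q) ^ Y.card * ((1 / 2) ^ t * S) := by
      intro Y
      rw [Finset.sum_const, Finset.card_powerset, nsmul_eq_mul, show 4 * q = 2 * (2 * q) by ring,
        mul_pow 2 (2 * q)]
      push_cast
      ring
    simp only [h2]
    rw [← Finset.sum_mul]
    have h3 : ∑ Y ∈ (termVars T).powerset, (4 * q) ^ Y.card = (1 + 4 * q) ^ (termVars T).card := by
      rw [add_comm, ← Finset.sum_pow_mul_eq_add_pow]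
      simp
    have h4 := Finset.add_sum_erase (termVars T).powerset (fun Y => (4 * q) ^ Y.card)
      (Finset.empty_mem_powerset _)
    simp only [Finset.card_empty, pow_zero] at h4
    have h5 : ∑ Y ∈ (termVars T).powerset.erase ∅, (4 * q) ^ Y.card ≤ 1 := by linarith
    exact mul_le_of_le_one_left (by positivity) h5
  have hsplit : mass p (fun ρ => Δ ρ ∧ t ≤ dt (restrict F ρ)) ≤
      mass p (fun ρ => (Δ ρ ∧ Fals ρ) ∧ t ≤ dt (restrict F ρ)) +
      mass p (fun ρ => (Δ ρ ∧ ¬ Fals ρ) ∧ t ≤ dt (restrict F ρ)) :=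
    mass_le_add h0 h1 fun ρ h => by
      by_cases h2 : Fals ρ
      exacts [Or.inl ⟨⟨h.1, h2⟩, h.2⟩, Or.inr ⟨⟨h.1, h2⟩, h.2⟩]
  have hjoin : mass p (fun ρ => Δ ρ ∧ Fals ρ) + S ≤ mass p Δ := by
    refine mass_add_le h0 h1 (fun ρ h => h.1) (fun ρ h => h.1) ?_
    rintro ρ ⟨_, i, b, hi, hρ⟩ ⟨_, h2⟩
    have := h2 i (mem_termVars.2 (by simp [hi]))
    rw [hρ, hi] at this
    simp at this
  have := mul_le_mul_of_nonneg_left hjoin (show (0 : ℝ) ≤ (1 / 2) ^ t by positivity)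
  linarith

omit [Fintype ι] [DecidableEq ι] h0 h1 in
theorem sat_subst_iff (T θ : ι → Option Bool)
    (h : ∀ i b, T i = some b → θ i ≠ some (!b)) (x : ι → Bool) :
    Sat T (subst θ x) ↔ Sat (fun i => if θ i = none then T i else none) x := by
  constructor
  · intro hs i b hb
    by_cases hi : θ i = none
    · simp only [hi, if_true] at hb
      simpa [subst, hi] using hs i b hb
    · simp [hi] at hb
  · intro hs i b hb
    cases hi : θ i with
    | none => simpa [subst, hi] using hs i b (by simp [hi, hb])
    | some c =>
      have := h i b hb
      rw [hi] at this
      simp only [subst, hi, Option.getD_some]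
      cases b <;> cases c <;> simp_all

/-- The switching lemma. -/
theorem IsDNF.switches {q : ℝ} (hq : 0 ≤ q) (hpq : p = q * ((1 - p) / 2)) {w : ℕ}
    (hw : (1 + 4 * q) ^ w ≤ 2) {f : (ι → Bool) → Bool} (hf : IsDNF w f) : Switches p f := by
  classical
  -- All restrictions `θ` are carried through the induction, because `Switches.or_term` needs every
  -- restriction of the remaining DNF to switch.
  have key : ∀ (S : Finset (ι → Option Bool)), (∀ T ∈ S, (termVars T).card ≤ w) →
      ∀ θ, Switches p (restrict (fun x => decide (∃ T ∈ S, Sat T x)) θ) := by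
    intro S
    induction S using Finset.induction_on with
    | empty => exact fun _ θ => Switches.of_const h0 h1 fun x y => by simp [restrict]
    | insert T S hTS ih =>
      intro hS θ
      have ih := ih fun T hT => hS T (Finset.mem_insert_of_mem hT)
      by_cases hcon : ∀ i b, T i = some b → θ i ≠ some (!b)
      · refine Switches.or_term h0 h1 hq hpq (T := fun i => if θ i = none then T i else none)
          (g := restrict (fun x => decide (∃ T ∈ S, Sat T x)) θ) ?_ (fun x => ?_) fun θ' => ?_
        · refine le_trans (pow_le_pow_right₀ (by linarith) ?_) hw
          refine le_trans (Finset.card_le_card fun i hi => ?_) (hS T (Finset.mem_insert_self _ _))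
          rw [mem_termVars] at hi ⊢
          by_cases h2 : θ i = none
          · simpa only [h2, if_true] using hi
          · simp [h2] at hi
        · simp [restrict, ← sat_subst_iff T θ hcon x]
        · rw [restrict_restrict]
          exact ih _
      · push Not at hcon
        obtain ⟨i, b, hT, hi⟩ := hcon
        convert ih θ using 1
        funext x
        have : ¬ Sat T (subst θ x) := fun hs => by
          have := hs i b hT
          simp [subst, hi] at this
        simp [restrict, this]
  have := key (Finset.univ.filter fun T => (termVars T).card ≤ w ∧ ∀ y, Sat T y → f y = true)
    (fun T hT => (Finset.mem_filter.1 hT).2.1) (fun _ => none)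
  rw [restrict_none] at this
  convert this using 1
  funext x
  rw [Bool.eq_iff_iff, decide_eq_true_iff]
  constructor
  · intro hx
    obtain ⟨T, h2, h3, h4⟩ := hf x hx
    exact ⟨T, by simpa using ⟨h2, h4⟩, h3⟩
  · rintro ⟨T, hT, hs⟩
    exact (Finset.mem_filter.1 hT).2.2 x hs

omit h0 h1 in
/-- The switching lemma, for restrictions with a free probability inverse to the width. -/
theorem IsDNF.switches_inv_width {w : ℕ} (hw : 1 ≤ w) {f : (ι → Bool) → Bool} (hf : IsDNF w f) :
    Switches (1 / (32 * w) : ℝ) f := by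
  have hw' : (1 : ℝ) ≤ w := by exact_mod_cast hw
  set p : ℝ := 1 / (32 * w) with hp
  have hp0 : 0 ≤ p := by positivity
  have hpw : p * w = 1 / 32 := by rw [hp]; field_simp
  have hp1 : p ≤ 1 / 32 := by nlinarith
  -- This `q` is the odds of free against a given fixed value. The width condition follows from `4 *
  -- q ≤ 16 * p` and `16 * p * w = 1 / 2`, as `exp (1 / 2) ≤ 2`.
  refine hf.switches hp0 (by linarith) (q := 2 * p / (1 - p))
    (div_nonneg (by linarith) (by linarith)) ?_ ?_
  · have : (1 : ℝ) - p ≠ 0 := by linarith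
    field_simp
  · have h2 : 4 * (2 * p / (1 - p)) ≤ 16 * p := by
      rw [← mul_div_assoc, div_le_iff₀ (by linarith)]
      nlinarith
    have h3 : 0 ≤ 2 * p / (1 - p) := div_nonneg (by linarith) (by linarith)
    calc (1 + 4 * (2 * p / (1 - p))) ^ w ≤ (Real.exp (16 * p)) ^ w := by
          refine pow_le_pow_left₀ (by linarith) ?_ w
          have := Real.add_one_le_exp (16 * p)
          linarith
      _ = Real.exp (1 / 2) := by
          rw [← Real.exp_nat_mul]
          congr 1
          linarith
      _ ≤ Real.exp (Real.log 2) := Real.exp_le_exp.2 (by have := Real.log_two_gt_d9; linarith)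
      _ = 2 := Real.exp_log (by norm_num)

end Switching

/-! ### Sensitivity to bias, and its behaviour under restrictions -/

section Bias

/-- The sign of a bit: `-1` for true and `1` for false. -/
def boolSign (b : Bool) : ℝ := if b then -1 else 1

variable {ι : Type*} [Fintype ι] [DecidableEq ι]

/-- The expectation of `f`, read as a sign, on independent coins of expectation `δ`. -/
noncomputable def biasedMean (δ : ℝ) (f : (ι → Bool) → Bool) : ℝ :=
  ∑ x : ι → Bool, (∏ i, (1 + δ * boolSign (x i)) / 2) * boolSign (f x)

theorem coin_nonneg {δ : ℝ} (hδ : |δ| ≤ 1) (b : Bool) : 0 ≤ (1 + δ * boolSign b) / 2 := by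
  have := abs_le.1 hδ
  cases b <;> simp [boolSign] <;> linarith

theorem abs_biasedMean_le {δ : ℝ} (hδ : |δ| ≤ 1) (f : (ι → Bool) → Bool) :
    |biasedMean δ f| ≤ 1 := by
  have htot : ∑ x : ι → Bool, ∏ i, (1 + δ * boolSign (x i)) / 2 = 1 := by
    have := Finset.prod_univ_sum (fun _ : ι => (Finset.univ : Finset Bool))
      (fun _ b => (1 + δ * boolSign b) / 2)
    rw [Fintype.piFinset_univ] at this
    rw [← this]
    refine Finset.prod_eq_one fun i _ => ?_
    simp [boolSign]
    ring
  rw [← htot]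
  refine (Finset.abs_sum_le_sum_abs _ _).trans (Finset.sum_le_sum fun x _ => ?_)
  have h2 : 0 ≤ ∏ i, (1 + δ * boolSign (x i)) / 2 :=
    Finset.prod_nonneg fun i _ => coin_nonneg hδ _
  have h3 : |boolSign (f x)| = 1 := by cases f x <;> simp [boolSign]
  rw [abs_mul, h3, mul_one, abs_of_nonneg h2]

theorem biasedMean_xor (δ : ℝ) (f : (ι → Bool) → Bool) (c : Bool) :
    biasedMean δ (fun x => xor c (f x)) = boolSign c * biasedMean δ f := by
  rw [biasedMean, biasedMean, Finset.mul_sum]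
  refine Finset.sum_congr rfl fun x _ => ?_
  cases c <;> cases f x <;> simp [boolSign]

theorem sum_eq_sum_update (H : (ι → Bool) → ℝ) (i : ι) :
    ∑ x, H x = ∑ x, (H (Function.update x i true) + H (Function.update x i false)) / 2 := by
  have hflip : ∑ x : ι → Bool, H (Function.update x i (!(x i))) = ∑ x, H x := by
    refine Fintype.sum_equiv (Function.Involutive.toPerm
      (fun x : ι → Bool => Function.update x i (!(x i))) fun x => ?_) _ _ fun x => rfl
    simp
  have : ∀ x : ι → Bool, H (Function.update x i true) + H (Function.update x i false) =
      H x + H (Function.update x i (!(x i))) := by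
    intro x
    cases hx : x i
    · rw [add_comm]
      congr 2
      rw [← hx, Function.update_eq_self]
    · congr 2
      rw [← hx, Function.update_eq_self]
  simp only [this, ← Finset.sum_div, Finset.sum_add_distrib, hflip]
  ring

theorem biasedMean_eq_update (δ : ℝ) (f : (ι → Bool) → Bool) (i : ι) :
    biasedMean δ f = (1 + δ) / 2 * biasedMean δ (fun x => f (Function.update x i false)) +
      (1 - δ) / 2 * biasedMean δ (fun x => f (Function.update x i true)) := by
  simp only [biasedMean]
  rw [sum_eq_sum_update _ i,
    sum_eq_sum_update (fun x => (∏ i, (1 + δ * boolSign (x i)) / 2) *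
      boolSign (f (Function.update x i false))) i,
    sum_eq_sum_update (fun x => (∏ i, (1 + δ * boolSign (x i)) / 2) *
      boolSign (f (Function.update x i true))) i, Finset.mul_sum, Finset.mul_sum,
    ← Finset.sum_add_distrib]
  refine Finset.sum_congr rfl fun x _ => ?_
  have hprod : ∀ b, ∏ j, (1 + δ * boolSign (Function.update x i b j)) / 2 =
      (1 + δ * boolSign b) / 2 * ∏ j ∈ Finset.univ.erase i, (1 + δ * boolSign (x j)) / 2 := by
    intro b
    rw [← Finset.mul_prod_erase _ _ (Finset.mem_univ i), Function.update_self]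
    congr 1
    refine Finset.prod_congr rfl fun j hj => ?_
    rw [Function.update_of_ne (Finset.ne_of_mem_erase hj)]
  have hs : boolSign true = -1 ∧ boolSign false = 1 := by simp [boolSign]
  simp only [hprod, Function.update_idem, hs.1, hs.2]
  ring

/-- Each query costs `|δ|`: the change at the root is a convex combination of the changes in the two
subtrees, plus `δ` times half the difference of their unbiased means. -/
theorem HasDT.abs_biasedMean_sub_le {t : ℕ} {f : (ι → Bool) → Bool} (h : HasDT t f) {δ : ℝ}
    (hδ : |δ| ≤ 1) : |biasedMean δ f - biasedMean 0 f| ≤ |δ| * t := by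
  induction h with
  | leaf t f hf =>
    obtain ⟨c, hc⟩ : ∃ c, ∀ x, f x = c := ⟨f (fun _ => true), fun x => hf _ _⟩
    have : ∀ δ : ℝ, biasedMean δ f = boolSign c := by
      intro δ
      have := Finset.prod_univ_sum (fun _ : ι => (Finset.univ : Finset Bool))
        (fun _ b => (1 + δ * boolSign b) / 2)
      rw [Fintype.piFinset_univ] at this
      simp only [biasedMean, hc]
      rw [← Finset.sum_mul, ← this, Finset.prod_eq_one, one_mul]
      intro i _
      simp [boolSign]
      ring
    rw [this, this, sub_self, abs_zero]
    positivity
  | query t f i _ ih =>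
    rw [biasedMean_eq_update δ f i, biasedMean_eq_update 0 f i]
    have hF := ih false
    have hT := ih true
    set a := biasedMean δ (fun x => f (Function.update x i false))
    set b := biasedMean δ (fun x => f (Function.update x i true))
    set a' := biasedMean 0 (fun x => f (Function.update x i false))
    set b' := biasedMean 0 (fun x => f (Function.update x i true))
    have ha : |a'| ≤ 1 := abs_biasedMean_le (by simp) _
    have hb : |b'| ≤ 1 := abs_biasedMean_le (by simp) _
    have hd := abs_le.1 hδ
    have e : (1 + δ) / 2 * a + (1 - δ) / 2 * b - ((1 + 0) / 2 * a' + (1 - 0) / 2 * b') =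
        (1 + δ) / 2 * (a - a') + (1 - δ) / 2 * (b - b') + δ * ((a' - b') / 2) := by ring
    rw [e]
    have h2 : |(1 + δ) / 2 * (a - a')| ≤ (1 + δ) / 2 * (|δ| * t) := by
      rw [abs_mul, abs_of_nonneg (by linarith)]
      exact mul_le_mul_of_nonneg_left hF (by linarith)
    have h3 : |(1 - δ) / 2 * (b - b')| ≤ (1 - δ) / 2 * (|δ| * t) := by
      rw [abs_mul, abs_of_nonneg (by linarith)]
      exact mul_le_mul_of_nonneg_left hT (by linarith)
    have h4 : |δ * ((a' - b') / 2)| ≤ |δ| := by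
      rw [abs_mul]
      refine mul_le_of_le_one_right (abs_nonneg _) ?_
      rw [abs_le] at *
      constructor <;> linarith
    refine (abs_add_three _ _ _).trans ?_
    push_cast
    linarith

theorem sum_restrictionProb (p : ℝ) : ∑ ρ : ι → Option Bool, restrictionProb p ρ = 1 := by
  have := Finset.prod_univ_sum (fun _ : ι => (Finset.univ : Finset (Option Bool)))
    (fun _ r => if r = none then p else (1 - p) / 2)
  rw [Fintype.piFinset_univ] at this
  simp only [restrictionProb]
  rw [← this]
  refine Finset.prod_eq_one fun i _ => ?_
  simp [Fintype.sum_option]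
  ring

/-- Both sides factor over the coordinates; a coin that is fair with probability `1 - p` and
`δ`-biased otherwise has expectation `p * δ`. -/
theorem sum_sum_subst_eq (p δ : ℝ) (y : ι → Bool) :
    ∑ ρ : ι → Option Bool, ∑ x : ι → Bool, (if subst ρ x = y then
      restrictionProb p ρ * ∏ i, (1 + δ * boolSign (x i)) / 2 else 0) =
    ∏ i, (1 + p * δ * boolSign (y i)) / 2 := by
  have hterm : ∀ (ρ : ι → Option Bool) (x : ι → Bool), (if subst ρ x = y then
      restrictionProb p ρ * ∏ i, (1 + δ * boolSign (x i)) / 2 else 0) =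
      ∏ i, if (ρ i).getD (x i) = y i then
        (if ρ i = none then p else (1 - p) / 2) * ((1 + δ * boolSign (x i)) / 2) else 0 := by
    intro ρ x
    rw [Finset.prod_ite_zero, restrictionProb, ← Finset.prod_mul_distrib]
    simp [funext_iff, subst]
  simp only [hterm]
  have h2 : ∀ ρ : ι → Option Bool, (∑ x : ι → Bool, ∏ i, if (ρ i).getD (x i) = y i then
        (if ρ i = none then p else (1 - p) / 2) * ((1 + δ * boolSign (x i)) / 2) else 0) =
      ∏ i, ∑ b : Bool, if (ρ i).getD b = y i then
        (if ρ i = none then p else (1 - p) / 2) * ((1 + δ * boolSign b) / 2) else 0 := by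
    intro ρ
    rw [Finset.prod_univ_sum, Fintype.piFinset_univ]
  simp only [h2]
  have h3 := Finset.prod_univ_sum (fun _ : ι => (Finset.univ : Finset (Option Bool)))
    (fun i r => ∑ b : Bool, if r.getD b = y i then
        (if r = none then p else (1 - p) / 2) * ((1 + δ * boolSign b) / 2) else 0)
  rw [Fintype.piFinset_univ] at h3
  rw [← h3]
  refine Finset.prod_congr rfl fun i _ => ?_
  cases y i <;> simp [Fintype.sum_option, boolSign] <;> ring

/-- Averaging over a random restriction shrinks the bias by the free probability. -/
theorem sum_restrictionProb_mul_biasedMean (p δ : ℝ) (f : (ι → Bool) → Bool) :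
    ∑ ρ, restrictionProb p ρ * biasedMean δ (restrict f ρ) = biasedMean (p * δ) f := by
  simp only [biasedMean, ← sum_sum_subst_eq]
  simp only [Finset.sum_mul, Finset.mul_sum]
  symm
  rw [Finset.sum_comm]
  refine Finset.sum_congr rfl fun ρ _ => ?_
  rw [Finset.sum_comm]
  refine Finset.sum_congr rfl fun x _ => ?_
  simp [restrict, mul_assoc]

theorem abs_biasedMean_sub_le_of_restrict {p B : ℝ} (h0 : 0 < p) (h1 : p ≤ 1) (hB : 2 ≤ B)
    {f : (ι → Bool) → Bool}
    (h : ∀ δ : ℝ, |δ| ≤ 1 → ∑ ρ, restrictionProb p ρ *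
      |biasedMean δ (restrict f ρ) - biasedMean 0 (restrict f ρ)| ≤ |δ| * B)
    {ε : ℝ} (hε : |ε| ≤ 1) : |biasedMean ε f - biasedMean 0 f| ≤ |ε| * (B / p) := by
  -- For `|ε| ≤ p` the hypothesis applies with `δ = ε / p`; beyond that `|ε| * (B / p)` exceeds 2,
  -- because `2 ≤ B`.
  by_cases hεp : |ε| ≤ p
  · have hd : |ε / p| ≤ 1 := by
      rw [abs_div, abs_of_pos h0, div_le_one h0]
      exact hεp
    have e1 := sum_restrictionProb_mul_biasedMean p (ε / p) f
    have e2 := sum_restrictionProb_mul_biasedMean p 0 f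
    rw [mul_div_cancel₀ _ h0.ne'] at e1
    rw [mul_zero] at e2
    rw [← e1, ← e2, ← Finset.sum_sub_distrib]
    refine (Finset.abs_sum_le_sum_abs _ _).trans ?_
    have h2 := h _ hd
    rw [abs_div, abs_of_pos h0] at h2
    refine le_trans (le_of_eq (Finset.sum_congr rfl fun ρ _ => ?_)) (h2.trans (le_of_eq (by ring)))
    rw [← mul_sub, abs_mul, abs_of_nonneg (restrictionProb_nonneg h0.le h1 ρ)]
  · push Not at hεp
    have h2 := abs_le.1 (abs_biasedMean_le hε f)
    have h3 := abs_le.1 (abs_biasedMean_le (δ := 0) (by simp) f)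
    have h4 : |biasedMean ε f - biasedMean 0 f| ≤ 2 := abs_le.2 ⟨by linarith, by linarith⟩
    refine h4.trans ?_
    rw [← mul_div_assoc, le_div_iff₀ h0]
    nlinarith

/-- The mean is the sum of the tail probabilities, here at most `1 / 2 + 1 / 4 + ...`. -/
theorem Switches.sum_dt_le {p : ℝ} {f : (ι → Bool) → Bool}
    (hf : Switches p f) : ∑ ρ, restrictionProb p ρ * (dt (restrict f ρ) : ℝ) ≤ 1 := by
  classical
  have hdt : ∀ ρ : ι → Option Bool, (dt (restrict f ρ) : ℝ) =
      ∑ k ∈ Finset.range (Fintype.card ι), if k + 1 ≤ dt (restrict f ρ) then (1 : ℝ) else 0 := by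
    intro ρ
    rw [← Finset.sum_filter, Finset.sum_const, nsmul_eq_mul, mul_one]
    congr 1
    have : (Finset.range (Fintype.card ι)).filter (fun k => k + 1 ≤ dt (restrict f ρ)) =
        Finset.range (dt (restrict f ρ)) := by
      ext k
      have := dt_le_card (restrict f ρ)
      simp only [Finset.mem_filter, Finset.mem_range]
      omega
    rw [this, Finset.card_range]
  have htrue : mass p (fun _ : ι → Option Bool => True) = 1 := by
    simp [mass, sum_restrictionProb]
  calc ∑ ρ, restrictionProb p ρ * (dt (restrict f ρ) : ℝ)
      = ∑ k ∈ Finset.range (Fintype.card ι),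
          mass p (fun ρ => True ∧ k + 1 ≤ dt (restrict f ρ)) := by
        simp only [hdt, Finset.mul_sum, mass]
        rw [Finset.sum_comm]
        simp
    _ ≤ ∑ k ∈ Finset.range (Fintype.card ι), (1 / 2 : ℝ) ^ (k + 1) := by
        refine Finset.sum_le_sum fun k _ => ?_
        have := hf (fun _ => True) (fun _ _ _ _ => trivial) (k + 1)
        rwa [htrue, mul_one] at this
    _ ≤ 1 := by
        have : ∀ n : ℕ, ∑ k ∈ Finset.range n, (1 / 2 : ℝ) ^ (k + 1) = 1 - (1 / 2) ^ n := by
          intro n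
          induction n with
          | zero => simp
          | succ n ih => rw [Finset.sum_range_succ, ih, pow_succ]; ring
        rw [this]
        have : (0 : ℝ) ≤ (1 / 2) ^ Fintype.card ι := by positivity
        linarith

/-- If each `f|ρ` has decision tree depth `B` on average, then `f` is insensitive to bias. -/
theorem abs_biasedMean_sub_le_of_dt {p B : ℝ} (h0 : 0 < p) (h1 : p ≤ 1) (hB : 2 ≤ B)
    {f : (ι → Bool) → Bool}
    (h : ∑ ρ, restrictionProb p ρ * (dt (restrict f ρ) : ℝ) ≤ B)
    {ε : ℝ} (hε : |ε| ≤ 1) : |biasedMean ε f - biasedMean 0 f| ≤ |ε| * (B / p) := by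
  refine abs_biasedMean_sub_le_of_restrict h0 h1 hB (fun δ hδ => ?_) hε
  refine le_trans ?_ (mul_le_mul_of_nonneg_left h (abs_nonneg δ))
  rw [Finset.mul_sum]
  refine Finset.sum_le_sum fun ρ _ => ?_
  have := mul_le_mul_of_nonneg_left ((hasDT_dt (restrict f ρ)).abs_biasedMean_sub_le hδ)
    (restrictionProb_nonneg h0.le h1 ρ)
  linarith

end Bias

/-! ### Sensitivity of narrow DNFs -/

section DNFBias

variable {ι : Type*} [Fintype ι] [DecidableEq ι]

theorem abs_biasedMean_sub_xor (δ : ℝ) (f : (ι → Bool) → Bool) (c : Bool) :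
    |biasedMean δ (fun x => xor c (f x)) - biasedMean 0 (fun x => xor c (f x))| =
      |biasedMean δ f - biasedMean 0 f| := by
  rw [biasedMean_xor, biasedMean_xor, ← mul_sub, abs_mul]
  cases c <;> simp [boolSign]

omit [DecidableEq ι] in
theorem IsDNF.restrict {w : ℕ} {f : (ι → Bool) → Bool} (hf : IsDNF w f) (θ : ι → Option Bool) :
    IsDNF w (restrict f θ) := by
  intro x hx
  obtain ⟨T, hT, hs, hy⟩ := hf _ hx
  have hcon : ∀ i b, T i = some b → θ i ≠ some (!b) := by
    intro i b hi h
    have := hs i b hi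
    simp [subst, h] at this
  refine ⟨fun i => if θ i = none then T i else none, ?_, (sat_subst_iff T θ hcon x).1 hs,
    fun y h => hy _ ((sat_subst_iff T θ hcon y).2 h)⟩
  refine (Finset.card_le_card fun i hi => ?_).trans hT
  rw [mem_termVars] at hi ⊢
  by_cases h2 : θ i = none
  · simpa only [h2, if_true] using hi
  · simp [h2] at hi

theorem IsDNF.sum_dt_le {w : ℕ} (hw : 1 ≤ w) {f : (ι → Bool) → Bool} (hf : IsDNF w f) :
    ∑ ρ, restrictionProb (1 / (32 * w) : ℝ) ρ * (dt (_root_.restrict f ρ) : ℝ) ≤ 1 :=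
  (hf.switches_inv_width hw).sum_dt_le

theorem inv_width_pos {w : ℕ} (hw : 1 ≤ w) : (0 : ℝ) < 1 / (32 * w) := by
  have : (1 : ℝ) ≤ w := by exact_mod_cast hw
  positivity

theorem inv_width_le_one {w : ℕ} (hw : 1 ≤ w) : (1 / (32 * w) : ℝ) ≤ 1 := by
  have : (1 : ℝ) ≤ w := by exact_mod_cast hw
  rw [div_le_one (by positivity)]
  linarith

theorem IsDNF.abs_biasedMean_sub_le {w : ℕ} (hw : 1 ≤ w) {f : (ι → Bool) → Bool}
    (hf : IsDNF w f) {ε : ℝ} (hε : |ε| ≤ 1) :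
    |biasedMean ε f - biasedMean 0 f| ≤ |ε| * (64 * w) := by
  refine (abs_biasedMean_sub_le_of_dt (inv_width_pos hw) (inv_width_le_one hw) le_rfl
    ((hf.sum_dt_le hw).trans one_le_two) hε).trans (le_of_eq ?_)
  have : (1 : ℝ) ≤ w := by exact_mod_cast hw
  field_simp
  ring

end DNFBias

/-! ### Gates as ORs of shallow decision trees -/

section Wires

theorem hasDT_wire {n m t : ℕ} (ht : 1 ≤ t) (G : Fin m → (Fin n → Bool) → Bool)
    (θ : Fin n → Option Bool) (w : CircuitWire n m)
    (hG : ∀ j, w.node = .gate j → HasDT t (restrict (G j) θ)) :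
    HasDT t (restrict (fun x => w.eval x (fun j => G j x)) θ) := by
  suffices h : HasDT t (restrict (fun x => match w.node with
      | .const b => b
      | .var i => x i
      | .gate j => G j x) θ) from h.comp (xor w.negated)
  cases hw : w.node with
  | const b => exact .leaf _ _ fun _ _ => rfl
  | var i =>
    refine HasDT.restrict (HasDT.mono (.query 0 _ i fun b => .leaf _ _ fun x y => ?_) ht) θ
    simp
  | gate j => exact hG j hw

end Wires

namespace BoolCircuit

variable {n : ℕ} (C : BoolCircuit n)

/-- De Morgan: negating AND gates and their inputs lets both kinds of gate be treated as ORs. -/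
theorem xor_gateVal_iff (i : Fin C.size) (x : Fin n → Bool) :
    xor (C.isAnd i) (C.gateVal x i) = true ↔ ∃ w ∈ C.inputs i,
      xor (C.isAnd i) (w.eval x
        (fun j : Fin i.val => C.gateVal x ⟨j.val, j.isLt.trans i.isLt⟩)) = true := by
  rw [gateVal]
  cases C.isAnd i <;> simp

theorem gateDepth_lt_of_mem {i : Fin C.size} {w : CircuitWire n i.val} (hw : w ∈ C.inputs i)
    {j : Fin i.val} (hj : w.node = .gate j) :
    C.gateDepth ⟨j.val, j.isLt.trans i.isLt⟩ < C.gateDepth i := by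
  have e : C.gateDepth i = 1 + (C.inputs i).sup (fun w =>
      w.depth (fun j : Fin i.val => C.gateDepth ⟨j.val, j.isLt.trans i.isLt⟩)) := by
    rw [gateDepth]
  rw [e]
  have := Finset.le_sup (f := fun w : CircuitWire n i.val =>
    w.depth (fun j : Fin i.val => C.gateDepth ⟨j.val, j.isLt.trans i.isLt⟩)) hw
  simp only [CircuitWire.depth, hj] at this
  exact Nat.lt_one_add_iff.2 this

/-- Under the restriction `θ`, the gates of depth at most `k` have decision trees of depth at
most `t`. -/
def Shallow (k t : ℕ) (θ : Fin n → Option Bool) : Prop :=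
  ∀ j, C.gateDepth j ≤ k → HasDT t (restrict (fun x => C.gateVal x j) θ)

variable {C}

theorem Shallow.isDNF {k t : ℕ} {θ : Fin n → Option Bool} (h : C.Shallow k t θ) (ht : 1 ≤ t)
    {i : Fin C.size} (hi : C.gateDepth i ≤ k + 1) :
    IsDNF t (fun x => xor (C.isAnd i) (restrict (fun x => C.gateVal x i) θ x)) := by
  refine IsDNF.of_exists (fun w => w ∈ C.inputs i)
    (fun w x => xor (C.isAnd i) (restrict (fun x => w.eval x
      (fun j : Fin i.val => C.gateVal x ⟨j.val, j.isLt.trans i.isLt⟩)) θ x))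
    (fun x => C.xor_gateVal_iff i _) fun w hw => ?_
  refine (hasDT_wire ht (fun (j : Fin i.val) x => C.gateVal x ⟨j.val, j.isLt.trans i.isLt⟩) θ w
    fun j hj => h _ ?_).comp _
  have := C.gateDepth_lt_of_mem hw hj
  omega

theorem Shallow.abs_biasedMean_sub_le {k t : ℕ} {θ : Fin n → Option Bool} (h : C.Shallow k t θ)
    (ht : 1 ≤ t) {i : Fin C.size} (hi : C.gateDepth i ≤ k + 1) {ε : ℝ} (hε : |ε| ≤ 1) :
    |biasedMean ε (restrict (fun x => C.gateVal x i) θ) -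
      biasedMean 0 (restrict (fun x => C.gateVal x i) θ)| ≤ |ε| * (64 * t) := by
  rw [← abs_biasedMean_sub_xor ε _ (C.isAnd i)]
  exact (h.isDNF ht hi).abs_biasedMean_sub_le ht hε

/-! ### The crude bound, linear in the size -/

variable (C)

open Classical in
/-- The part of a gate that reads variables and constants directly: an OR of literals, which is
the negation of their AND for an AND gate. -/
noncomputable def literalPart (i : Fin C.size) (x : Fin n → Bool) : Bool :=
  decide (∃ w, (w ∈ C.inputs i ∧ ∀ j, w.node ≠ .gate j) ∧
    xor (C.isAnd i) (w.eval x (fun _ => false)) = true)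

theorem literalPart_iff (i : Fin C.size) (x : Fin n → Bool) :
    C.literalPart i x = true ↔ ∃ w, (w ∈ C.inputs i ∧ ∀ j, w.node ≠ .gate j) ∧
      xor (C.isAnd i) (w.eval x (fun _ => false)) = true := by
  simp [literalPart]

theorem isDNF_literalPart (i : Fin C.size) : IsDNF 1 (C.literalPart i) := by
  refine IsDNF.of_exists (fun w => w ∈ C.inputs i ∧ ∀ j, w.node ≠ .gate j)
    (fun w x => xor (C.isAnd i) (w.eval x (fun _ => false)))
    (C.literalPart_iff i) fun w hw => ?_
  exact (hasDT_wire le_rfl (fun _ _ => false) (fun _ => none) w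
    fun j hj => absurd hj (hw.2 j)).comp _

/-- Induction along the topological order: each gate is a function of its literal part and of
earlier gates. -/
theorem gateVal_eq_of_literalPart_eq {x y : Fin n → Bool}
    (h : ∀ j, C.literalPart j x = C.literalPart j y) (i : Fin C.size) :
    C.gateVal x i = C.gateVal y i := by
  have key : ∀ (m : ℕ) (x y : Fin n → Bool), (∀ j, C.literalPart j x = C.literalPart j y) →
      ∀ i : Fin C.size, i.val < m → xor (C.isAnd i) (C.gateVal x i) = true →
        xor (C.isAnd i) (C.gateVal y i) = true := by
    intro m
    induction m with
    | zero => intro _ _ _ _ hi; omega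
    | succ m ih =>
      intro x y h i hi hx
      obtain ⟨w, hw, hwx⟩ := (C.xor_gateVal_iff i x).1 hx
      by_cases hg : ∃ j, w.node = .gate j
      · obtain ⟨j, hj⟩ := hg
        refine (C.xor_gateVal_iff i y).2 ⟨w, hw, ?_⟩
        rw [← hwx]
        have hlt : j.val < m := by have := j.isLt; omega
        have h1 := ih x y h ⟨j.val, j.isLt.trans i.isLt⟩ hlt
        have h2 := ih y x (fun j => (h j).symm) ⟨j.val, j.isLt.trans i.isLt⟩ hlt
        have h3 : C.gateVal x ⟨j.val, j.isLt.trans i.isLt⟩ =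
            C.gateVal y ⟨j.val, j.isLt.trans i.isLt⟩ :=
          (Bool.xor_right_inj (x := C.isAnd ⟨j.val, j.isLt.trans i.isLt⟩)).1
            (Bool.eq_iff_iff.2 ⟨h1, h2⟩)
        simp only [CircuitWire.eval, hj, h3]
      · push Not at hg
        have hev : ∀ (x : Fin n → Bool) (g g' : Fin i.val → Bool), ∀ w : CircuitWire n i.val,
            (∀ j, w.node ≠ .gate j) → w.eval x g = w.eval x g' := by
          intro x g g' w hg
          cases hn : w.node with
          | gate j => exact absurd hn (hg j)
          | _ => simp only [CircuitWire.eval, hn]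
        have hlx : C.literalPart i x = true :=
          (C.literalPart_iff i x).2 ⟨w, ⟨hw, hg⟩, by rw [hev x _ _ w hg]; exact hwx⟩
        rw [h i, literalPart_iff] at hlx
        obtain ⟨v, ⟨hv, hvg⟩, hvy⟩ := hlx
        exact (C.xor_gateVal_iff i y).2 ⟨v, hv, by rw [hev y _ _ v hvg]; exact hvy⟩
  refine (Bool.xor_right_inj (x := C.isAnd i)).1 (Bool.eq_iff_iff.2 ⟨?_, ?_⟩)
  · exact key (i.val + 1) x y h i (Nat.lt_succ_self _)
  · exact key (i.val + 1) y x (fun j => (h j).symm) i (Nat.lt_succ_self _)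

/-- A bound that depends only on the size of the circuit. -/
theorem abs_biasedMean_sub_le_of_size {s : ℕ} (hs : 2 ≤ s) (hC : C.size ≤ s)
    (θ : Fin n → Option Bool) (i : Fin C.size) {ε : ℝ} (hε : |ε| ≤ 1) :
    |biasedMean ε (restrict (fun x => C.gateVal x i) θ) -
      biasedMean 0 (restrict (fun x => C.gateVal x i) θ)| ≤ |ε| * (32 * s) := by
  have hp0 := inv_width_pos le_rfl
  have hp1 := inv_width_le_one le_rfl
  -- With `p = 1 / 32` each literal part has mean tree depth at most 1. The trees of all literal
  -- parts, run in sequence, determine the gate, so `B = s` suffices.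
  refine (abs_biasedMean_sub_le_of_dt (B := s) hp0 hp1 (by exact_mod_cast hs) ?_ hε).trans
    (le_of_eq (by push_cast; ring))
  have hdt : ∀ ρ : Fin n → Option Bool,
      dt (restrict (restrict (fun x => C.gateVal x i) θ) ρ) ≤
        ∑ j, dt (restrict (restrict (C.literalPart j) θ) ρ) := fun ρ =>
    dt_le_of_hasDT (HasDT.of_determined Finset.univ _
      (fun j => restrict (restrict (C.literalPart j) θ) ρ) _
      (fun x y h => C.gateVal_eq_of_literalPart_eq (fun j => h j (Finset.mem_univ j)) i)
      fun j _ => hasDT_dt _)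
  calc _ ≤ ∑ ρ, restrictionProb (1 / (32 * (1 : ℕ)) : ℝ) ρ *
          ∑ j, (dt (restrict (restrict (C.literalPart j) θ) ρ) : ℝ) :=
        Finset.sum_le_sum fun ρ _ => mul_le_mul_of_nonneg_left (by exact_mod_cast hdt ρ)
          (restrictionProb_nonneg hp0.le hp1 ρ)
    _ = ∑ j, ∑ ρ, restrictionProb (1 / (32 * (1 : ℕ)) : ℝ) ρ *
          (dt (restrict (restrict (C.literalPart j) θ) ρ) : ℝ) := by
        simp only [Finset.mul_sum]
        rw [Finset.sum_comm]
    _ ≤ ∑ _j : Fin C.size, (1 : ℝ) :=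
        Finset.sum_le_sum fun j _ => ((C.isDNF_literalPart j).restrict θ).sum_dt_le le_rfl
    _ ≤ s := by simpa using hC

/-! ### Induction on the layers of the circuit -/

variable {C}

/-- A union bound over the gates of depth at most `k + 1`, each a width-`w` DNF up to negation. -/
theorem Shallow.mass_not_shallow_le {k w t : ℕ} {θ : Fin n → Option Bool}
    (h : C.Shallow k w θ) (hw : 1 ≤ w) :
    mass (1 / (32 * w) : ℝ) (fun ρ => ¬ C.Shallow (k + 1) t (fun i => (θ i).or (ρ i))) ≤
      C.size * (1 / 2) ^ (t + 1) := by
  have hp0 := inv_width_pos hw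
  have hp1 := inv_width_le_one hw
  refine (mass_le_sum hp0.le hp1 (Finset.univ.filter fun j => C.gateDepth j ≤ k + 1)
    (Q := fun j ρ => True ∧ t + 1 ≤
      dt (restrict (restrict (fun x => C.gateVal x j) θ) ρ)) fun ρ hρ => ?_).trans ?_
  · simp only [Shallow] at hρ
    push Not at hρ
    obtain ⟨j, hj, hdt⟩ := hρ
    refine ⟨j, by simpa using hj, trivial, ?_⟩
    by_contra hcon
    refine hdt ?_
    rw [← restrict_restrict]
    exact (hasDT_dt _).mono (by omega)
  · have htrue : mass (1 / (32 * w) : ℝ) (fun _ : Fin n → Option Bool => True) = 1 := by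
      simp only [mass, if_true, sum_restrictionProb]
    calc _ ≤ ∑ _j ∈ Finset.univ.filter fun j => C.gateDepth j ≤ k + 1,
            ((1 : ℝ) / 2) ^ (t + 1) := by
          refine Finset.sum_le_sum fun j hj => ?_
          have := (h.isDNF hw (Finset.mem_filter.1 hj).2).switches_inv_width hw (fun _ => True)
            (fun _ _ _ _ => trivial) (t + 1)
          rw [htrue, mul_one] at this
          have e : ∀ ρ, dt (restrict (fun x => xor (C.isAnd j)
              (restrict (fun x => C.gateVal x j) θ x)) ρ) =
              dt (restrict (restrict (fun x => C.gateVal x j) θ) ρ) := fun ρ =>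
            dt_comp_not (restrict (restrict (fun x => C.gateVal x j) θ) ρ) (C.isAnd j)
          simp only [e] at this
          exact this
      _ ≤ _ := by
          rw [Finset.sum_const, nsmul_eq_mul]
          refine mul_le_mul_of_nonneg_right ?_ (by positivity)
          exact Nat.cast_le.2 ((Finset.card_filter_le _ _).trans (Finset.card_fin _).le)

theorem Shallow.step {k w t s : ℕ} {θ : Fin n → Option Bool} (h : C.Shallow k w θ) (hw : 1 ≤ w)
    (hs : 2 ≤ s) (hC : C.size ≤ s) (hst : 32 * s ^ 2 ≤ 2 ^ (t + 1)) {B : ℝ} (hB : 1 ≤ B)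
    {i : Fin C.size}
    (hstep : ∀ θ', C.Shallow (k + 1) t θ' → ∀ δ : ℝ, |δ| ≤ 1 →
      |biasedMean δ (restrict (fun x => C.gateVal x i) θ') -
        biasedMean 0 (restrict (fun x => C.gateVal x i) θ')| ≤ |δ| * B)
    {ε : ℝ} (hε : |ε| ≤ 1) :
    |biasedMean ε (restrict (fun x => C.gateVal x i) θ) -
      biasedMean 0 (restrict (fun x => C.gateVal x i) θ)| ≤ |ε| * (64 * w * B) := by
  classical
  have hp0 := inv_width_pos hw
  have hp1 := inv_width_le_one hw
  have hw' : (1 : ℝ) ≤ w := by exact_mod_cast hw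
  -- The extra 1 pays for the failure event: `32 * s` times its probability `s / 2 ^ (t + 1)`. Since
  -- `1 ≤ B`, `32 * w * (B + 1) ≤ 64 * w * B`.
  refine (abs_biasedMean_sub_le_of_restrict hp0 hp1 (B := B + 1) (by linarith)
    (fun δ hδ => ?_) hε).trans (mul_le_mul_of_nonneg_left ?_ (abs_nonneg ε))
  · have hpt : ∀ ρ : Fin n → Option Bool, restrictionProb (1 / (32 * w) : ℝ) ρ *
        |biasedMean δ (restrict (restrict (fun x => C.gateVal x i) θ) ρ) -
          biasedMean 0 (restrict (restrict (fun x => C.gateVal x i) θ) ρ)| ≤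
        |δ| * B * restrictionProb (1 / (32 * w) : ℝ) ρ + |δ| * (32 * s) *
          (if ¬ C.Shallow (k + 1) t (fun i => (θ i).or (ρ i)) then
            restrictionProb (1 / (32 * w) : ℝ) ρ else 0) := by
      intro ρ
      have h0 := restrictionProb_nonneg hp0.le hp1 ρ
      rw [restrict_restrict]
      by_cases hsh : C.Shallow (k + 1) t (fun i => (θ i).or (ρ i))
      · have := mul_le_mul_of_nonneg_left (hstep _ hsh δ hδ) h0
        simp only [hsh, not_true_eq_false, if_false]
        linarith
      · have := mul_le_mul_of_nonneg_left
          (C.abs_biasedMean_sub_le_of_size hs hC (fun i => (θ i).or (ρ i)) i hδ) h0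
        simp only [hsh, not_false_eq_true, if_true]
        have h2 : 0 ≤ |δ| * B * restrictionProb (1 / (32 * w) : ℝ) ρ := by positivity
        linarith
    refine (Finset.sum_le_sum fun ρ _ => hpt ρ).trans ?_
    rw [Finset.sum_add_distrib, ← Finset.mul_sum, ← Finset.mul_sum, sum_restrictionProb]
    have hm := h.mass_not_shallow_le (t := t) hw
    have hm' : mass (1 / (32 * w) : ℝ)
        (fun ρ => ¬ C.Shallow (k + 1) t (fun i => (θ i).or (ρ i))) ≤ s * (1 / 2) ^ (t + 1) :=
      hm.trans (mul_le_mul_of_nonneg_right (by exact_mod_cast hC) (by positivity))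
    have hone : (32 * s : ℝ) * (s * (1 / 2) ^ (t + 1)) ≤ 1 := by
      have h2 : (32 * s ^ 2 : ℝ) ≤ 2 ^ (t + 1) := by exact_mod_cast hst
      have h3 : (32 * s : ℝ) * (s * (1 / 2) ^ (t + 1)) = 32 * s ^ 2 / 2 ^ (t + 1) := by
        rw [one_div, inv_pow]; ring
      rw [h3, div_le_one (by positivity)]
      exact h2
    have h4 := (mul_le_mul_of_nonneg_left hm' (show (0 : ℝ) ≤ 32 * s by positivity)).trans hone
    have h5 := mul_le_mul_of_nonneg_left h4 (abs_nonneg δ)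
    simp only [mass] at h5
    convert add_le_add (le_refl (|δ| * B * 1)) h5 using 1
    · congr 1
      rw [mul_assoc]
      congr 3
      funext ρ
      congr
    · ring
  · rw [div_div_eq_mul_div, div_one]
    nlinarith

/-- `r` counts the restrictions still to be made before the gate is itself a narrow DNF, which
contributes the last factor. -/
theorem Shallow.abs_biasedMean_sub_le_pow {t s : ℕ} (ht : 1 ≤ t) (hs : 2 ≤ s) (hC : C.size ≤ s)
    (hst : 32 * s ^ 2 ≤ 2 ^ (t + 1)) {i : Fin C.size} (r : ℕ) :
    ∀ {k : ℕ} {θ : Fin n → Option Bool}, C.Shallow k t θ → C.gateDepth i ≤ k + 1 + r →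
      ∀ {ε : ℝ}, |ε| ≤ 1 → |biasedMean ε (restrict (fun x => C.gateVal x i) θ) -
        biasedMean 0 (restrict (fun x => C.gateVal x i) θ)| ≤ |ε| * (64 * t : ℝ) ^ (r + 1) := by
  have ht' : (1 : ℝ) ≤ t := by exact_mod_cast ht
  induction r with
  | zero =>
    intro k θ h hi ε hε
    rw [zero_add, pow_one]
    exact h.abs_biasedMean_sub_le ht hi hε
  | succ r ih =>
    intro k θ h hi ε hε
    have := h.step ht hs hC hst (B := (64 * t : ℝ) ^ (r + 1))
      (one_le_pow₀ (by linarith)) (fun θ' h' δ hδ => ih h' (by omega) hδ) hε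
    rwa [pow_succ' (64 * t : ℝ) (r + 1)]

theorem shallow_zero (C : BoolCircuit n) (t : ℕ) (θ : Fin n → Option Bool) :
    C.Shallow 0 t θ := by
  intro j hj
  rw [gateDepth] at hj
  omega

theorem abs_biasedMean_gate_sub_le {t s d : ℕ} (ht : 1 ≤ t) (hs : 2 ≤ s) (hC : C.size ≤ s)
    (hst : 32 * s ^ 2 ≤ 2 ^ (t + 1)) {i : Fin C.size} (hd : 1 ≤ d) (hi : C.gateDepth i ≤ d)
    {ε : ℝ} (hε : |ε| ≤ 1) :
    |biasedMean ε (fun x => C.gateVal x i) - biasedMean 0 (fun x => C.gateVal x i)| ≤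
      |ε| * (64 * (64 * t : ℝ) ^ (d - 1)) := by
  have ht' : (1 : ℝ) ≤ t := by exact_mod_cast ht
  rcases d with _ | _ | r
  · omega
  · have := (C.shallow_zero 1 (fun _ => none)).abs_biasedMean_sub_le le_rfl hi hε
    simpa [restrict_none] using this
  -- No gate has depth 0, so the first restriction may take width 1 and costs 64 instead of `64 *
  -- t`.
  · have := (C.shallow_zero 1 (fun _ => none)).step le_rfl hs hC hst
      (B := (64 * t : ℝ) ^ (r + 1)) (one_le_pow₀ (by linarith)) (i := i)
      (fun θ' h' δ hδ => h'.abs_biasedMean_sub_le_pow ht hs hC hst r (by omega) hδ) hε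
    simpa [restrict_none] using this

theorem abs_biasedMean_eval_sub_le {t s d : ℕ} (ht : 1 ≤ t) (hs : 2 ≤ s) (hC : C.size ≤ s)
    (hst : 32 * s ^ 2 ≤ 2 ^ (t + 1)) (hd : 1 ≤ d) (hCd : C.depth ≤ d)
    {ε : ℝ} (hε : |ε| ≤ 1) :
    |biasedMean ε C.eval - biasedMean 0 C.eval| ≤ |ε| * (64 * (64 * t : ℝ) ^ (d - 1)) := by
  have ht' : (1 : ℝ) ≤ t := by exact_mod_cast ht
  by_cases hg : ∃ j, C.output.node = .gate j
  · obtain ⟨j, hj⟩ := hg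
    have heval : C.eval = fun x => xor C.output.negated (C.gateVal x j) := by
      funext x
      simp only [eval, CircuitWire.eval, hj]
    rw [heval, abs_biasedMean_sub_xor]
    refine abs_biasedMean_gate_sub_le ht hs hC hst hd ?_ hε
    simpa only [depth, CircuitWire.depth, hj] using hCd
  · push Not at hg
    have hdt : HasDT 1 C.eval := hasDT_wire le_rfl (fun j x => C.gateVal x j) (fun _ => none)
      C.output fun j hj => absurd hj (hg j)
    refine (hdt.abs_biasedMean_sub_le hε).trans (mul_le_mul_of_nonneg_left ?_ (abs_nonneg ε))
    have : (1 : ℝ) ≤ (64 * t : ℝ) ^ (d - 1) := one_le_pow₀ (by linarith)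
    push_cast
    linarith

end BoolCircuit

/-! ### Transfer from signs to bits, and the choice of constants -/

theorem boolSign_signToBool (u : ℤˣ) : boolSign (signToBool u) = ((u : ℤ) : ℝ) := by
  rcases Int.units_eq_one_or u with rfl | rfl
  · simp [signToBool, boolSign, show ¬ ((1 : ℤˣ) = -1) by decide]
  · simp [signToBool, boolSign]

theorem signToBool_bijective : Function.Bijective signToBool := by decide

theorem coinExpectation_eq_biasedMean {n : ℕ} (δ : ℝ) {f : (Fin n → ℤˣ) → ℤˣ}
    {g : (Fin n → Bool) → Bool} (h : ∀ x, g (fun i => signToBool (x i)) = signToBool (f x)) :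
    coinExpectation δ f = biasedMean δ g := by
  refine Fintype.sum_equiv
    (Equiv.piCongrRight fun _ => Equiv.ofBijective _ signToBool_bijective) _ _ fun x => ?_
  change _ = (∏ i, (1 + δ * boolSign (signToBool (x i))) / 2) *
    boolSign (g (fun i => signToBool (x i)))
  simp only [h, boolSign_signToBool, coinProb]

theorem mainTheorem6 (d : ℕ) (hd : 1 ≤ d) :
    ∃ K : ℝ, 0 < K ∧
      ∀ (n s : ℕ) (f : (Fin n → ℤˣ) → ℤˣ) (ε : ℝ),
        2 ≤ s → ComputableByCircuit f s d → |ε| ≤ 1 →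
          |coinExpectation ε f - coinExpectation 0 f| ≤
            |ε| * (K * Real.log (s : ℝ) ^ (d - 1)) := by
  -- `1024 = 64 * 16`: the tree depth is `t = 8 * l` with `l = Nat.log 2 s`, and `8 * l ≤ 16 *
  -- Real.log s` because `Real.log 2 > 1 / 2`.
  refine ⟨64 * 1024 ^ (d - 1), by positivity, ?_⟩
  rintro n s f ε hs ⟨C, hC, hCd, hf⟩ hε
  rw [coinExpectation_eq_biasedMean ε hf, coinExpectation_eq_biasedMean 0 hf]
  set l := Nat.log 2 s with hl
  have hl1 : 1 ≤ l := Nat.log_pos (by norm_num) hs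
  -- The factor 8 is what `2 * l + 7 ≤ 8 * l + 1` needs at `l = 1`.
  have hst : 32 * s ^ 2 ≤ 2 ^ (8 * l + 1) := by
    have h1 : s ≤ 2 ^ (l + 1) := (Nat.lt_pow_succ_log_self (by norm_num) s).le
    calc 32 * s ^ 2 ≤ 2 ^ 5 * (2 ^ (l + 1)) ^ 2 :=
          Nat.mul_le_mul (by norm_num) (Nat.pow_le_pow_left h1 2)
      _ = 2 ^ (5 + (l + 1) * 2) := by rw [← pow_mul, ← pow_add]
      _ ≤ _ := Nat.pow_le_pow_right (by norm_num) (by omega)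
  have hlog : ((8 * l : ℕ) : ℝ) ≤ 16 * Real.log s := by
    have h1 : ((2 : ℝ)) ^ l ≤ s := by exact_mod_cast Nat.pow_log_le_self 2 (by omega)
    have h2 := Real.log_le_log (by positivity) h1
    rw [Real.log_pow] at h2
    have h3 := Real.log_two_gt_d9
    have h4 : (1 : ℝ) ≤ l := by exact_mod_cast hl1
    push_cast
    nlinarith
  refine (BoolCircuit.abs_biasedMean_eval_sub_le (t := 8 * l) (by omega) hs hC hst hd hCd
    hε).trans (mul_le_mul_of_nonneg_left ?_ (abs_nonneg ε))
  rw [mul_assoc, ← mul_pow]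
  refine mul_le_mul_of_nonneg_left (pow_le_pow_left₀ (by positivity) ?_ _) (by norm_num)
  linarith
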